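/- **Theorem 1 (Quantum Leftover Hash Lemma With Non-Uniform Random Seeds).** Let $X$ and $S$ be finite sets with $|S| = 2^{l}$, let $\alpha \in \mathbb{N}$, and let $F_R = \{f_r\}_{r \in \{0,1\}^\alpha}$ be a universal family of $2^\alpha$ hash functions from $X$ to $S$, that is, for all $x \neq x'$ in $X$ the fraction of the seeds $r \in \{0,1\}^\alpha$ with $f_r(x) = f_r(x')$ is at most $1/|S|$. Let $P_{F_R}$ be a probability distribution on the seeds with min-entropy $H_{\min}(P_{F_R}) = -\log_2 \max_r P_{F_R}(f_r) \ge \beta$. Let $E$ be a quantum system with finite-dimensional Hilbert space $\mathcal{H}_E$, let $$\rho_{XE} = \sum_x |x\rangle\langle x|_X \otimes \rho_E^{[x]}$$ be a cq-state (each $\rho_E^{[x]} \ge 0$ and $\sum_x \mathrm{tr}\,\rho_E^{[x]} = 1$), and for each $r$ let $$\rho_{SE}^{[f_r]} = \sum_{s} |s\rangle\langle s|_S \otimes \rho_E^{[f_r,s]}, \qquad \rho_E^{[f_r,s]} = \sum_{x : f_r(x) = s} \rho_E^{[x]},$$ be the state of $S = f_r(X)$ and $E$ when the hash function is $f_r$.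 Then for every $\epsilon \ge 0$, $$\Delta = \sum_{r} P_{F_R}(f_r)\, D_u(S|E)_{\rho^{[f_r]}} \le \frac{1}{2} \cdot 2^{\alpha - \beta} \cdot 2^{-\frac{1}{2}\left(H_{\min}^{\epsilon}(\rho_{XE}|E) - l\right)} + \epsilon .$$ Here $D_u(S|E)_\rho = \frac{1}{2}\left\| \rho_{SE} - \frac{\mathbb{1}_S}{|S|} \otimes \rho_E \right\|_1$ is the distance from uniform, with $\|A\|_1 = \mathrm{tr}\sqrt{A^\dagger A}$ and $\rho_E = \mathrm{tr}_S\, \rho_{SE}$; the conditional min-entropy $H_{\min}(\rho_{XE}|E)$ of a nonnegative operator is the supremum of all real $t$ such that $\rho_{XE} \le 2^{-t}\, \mathbb{1}_X \otimes \sigma_E$ for some density operator $\sigma_E$ on $\mathcal{H}_E$; and $H_{\min}^{\epsilon}(\rho_{XE}|E)$ is the supremum of $H_{\min}(\rho'_{XE}|E)$ over all nonnegative operators $\rho'_{XE}$ on $\mathbb{C}^X \otimes \mathcal{H}_E$ with $\mathrm{tr}\,\rho' \le \mathrm{tr}\,\rho$ and $\|\rho_{XE} - \rho'_{XE}\|_1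 \le \epsilon\,\mathrm{tr}\,\rho$. If $H_{\min}^{\epsilon}(\rho_{XE}|E) = +\infty$, the first term on the right is $0$. -/

import Mathlib

open scoped ENNReal Kronecker ComplexOrder

namespace QLHL

noncomputable section

/-- The min-entropy (in bits) `H_min(P) = -log₂ max_r P(r)` of a distribution on a finite set. -/
def minEntropy {Ω : Type*} [Fintype Ω] (P : PMF Ω) : ℝ :=
  -Real.logb 2 (⨆ r, (P r).toReal)

/-- A (two-)universal family of hash functions `f_r : X → S`, indexed by a finite set of seeds:
for `x ≠ x'` the fraction of seeds with `f_r(x) = f_r(x')` is at most `1 / |S|`. -/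
def IsUniversalFamily {R X S : Type*} [Fintype R] [Fintype S] [DecidableEq S]
    (f : R → X → S) : Prop :=
  ∀ x x' : X, x ≠ x' →
    ((Finset.univ.filter fun r => f r x = f r x').card : ℝ) / (Fintype.card R : ℝ)
      ≤ 1 / (Fintype.card S : ℝ)

/-- The trace norm `‖A‖₁ = tr √(A† A)`: the sum of the singular values of `A`. -/
def traceNorm {n : Type*} [Fintype n] [DecidableEq n] (A : Matrix n n ℂ) : ℝ :=
  ∑ i, Real.sqrt ((Matrix.isHermitian_conjTranspose_mul_self A).eigenvalues i)

/-- Density operators on `ℂⁿ`. -/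
def IsDensity {n : Type*} [Fintype n] (ρ : Matrix n n ℂ) : Prop :=
  ρ.PosSemidef ∧ ρ.trace = 1

/-- The partial trace over the first tensor factor, `ρ_E = tr_A ρ_{AE}`. -/
def partialTrace {A E : Type*} [Fintype A] (ρ : Matrix (A × E) (A × E) ℂ) : Matrix E E ℂ :=
  Matrix.of fun e e' => ∑ a, ρ (a, e) (a, e')

/-- The operator `∑_x |x⟩⟨x| ⊗ ρ_E^[x]` on `ℂ^X ⊗ ℂ^E`. -/
def cqOperator {X E : Type*} [Fintype X] [DecidableEq X]
    (ρ : X → Matrix E E ℂ) : Matrix (X × E) (X × E) ℂ :=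
  ∑ x, Matrix.single x x (1 : ℂ) ⊗ₖ ρ x

/-- The operators `ρ_E^[f,s] = ∑_{x : f(x) = s} ρ_E^[x]` obtained by applying `f` to the
classical register. -/
def hashed {X S E : Type*} [Fintype X] [DecidableEq S]
    (f : X → S) (ρ : X → Matrix E E ℂ) : S → Matrix E E ℂ :=
  fun s => ∑ x with f x = s, ρ x

/-- The distance from uniform of `S` given `E`:
`D_u(S|E)_ρ = ½ ‖ρ_{SE} - ω_S ⊗ ρ_E‖₁`, with `ω_S` the maximally mixed state on `S`. -/
def distFromUniform {S E : Type*} [Fintype S] [DecidableEq S] [Fintype E] [DecidableEq E]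
    (ρ : Matrix (S × E) (S × E) ℂ) : ℝ :=
  (1 / 2) * traceNorm
    (ρ - ((Fintype.card S : ℂ)⁻¹ • (1 : Matrix S S ℂ)) ⊗ₖ partialTrace ρ)

/-- The conditional min-entropy `H_min(ρ_{AE}|E)`: the supremum of the real numbers `t` with
`ρ_{AE} ≤ 2^{-t} · 1_A ⊗ σ_E` for some density operator `σ_E`. -/
def condMinEntropy {A E : Type*} [Fintype A] [DecidableEq A] [Fintype E] [DecidableEq E]
    (ρ : Matrix (A × E) (A × E) ℂ) : EReal :=
  sSup {h : EReal | ∃ (t : ℝ) (σ : Matrix E E ℂ), IsDensity σ ∧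
    ((((2 : ℝ) ^ (-t) : ℝ) : ℂ) • ((1 : Matrix A A ℂ) ⊗ₖ σ) - ρ).PosSemidef ∧ h = (t : EReal)}

/-- The `ε`-smooth conditional min-entropy `H_min^ε(ρ_{AE}|E)`: the supremum of
`H_min(ρ'_{AE}|E)` over the nonnegative operators `ρ'` with `tr ρ' ≤ tr ρ` and
`‖ρ - ρ'‖₁ ≤ ε · tr ρ`. It is `⊤` if `ρ' = 0` is allowed. -/
def smoothCondMinEntropy {A E : Type*} [Fintype A] [DecidableEq A] [Fintype E] [DecidableEq E]
    (ε : ℝ) (ρ : Matrix (A × E) (A × E) ℂ) : EReal :=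
  sSup {h : EReal | ∃ ρ' : Matrix (A × E) (A × E) ℂ, ρ'.PosSemidef ∧
    ρ'.trace.re ≤ ρ.trace.re ∧ traceNorm (ρ - ρ') ≤ ε * ρ.trace.re ∧ h = condMinEntropy ρ'}

/-- `2^x` for an extended real `x`, with `2^{-∞} = 0` and `2^{+∞} = ∞`. -/
def twoPow (x : EReal) : ℝ≥0∞ :=
  EReal.exp (x * ((Real.log 2 : ℝ) : EReal))

end

end QLHL

/-!
The leftover hash lemma is a second-moment argument. The trace norm of a Hermitian operator is
attained by pairing it with a Hermitian contraction, its sign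
(`QLHL.exists_contraction_trace_eq`), so the distance from uniform becomes a sum over hash values
`s` of pairings `tr(U_s A_s)`, where `A_s = ρ_E^[f,s] - ρ_E / |S|` is linear in the blocks of
`ρ_{XE}` (`QLHL.deviation`).

Smoothing: for an admissible `ρ'`, the Jordan decomposition `ρ_{XE} - ρ' = Q - N` has
`tr Q + tr N ≤ ε`, and a positive operator `M` changes the sum of pairings by at most `2 tr M`
(`QLHL.abs_trace_mul_deviation_le`). After the factor `1/2` in the distance this costs `ε`, for each
seed and hence on average. Only the diagonal blocks of `ρ'` enter, so `ρ'` need not be a cq-operator.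

For the blocks of `ρ'`, which lie below `c σ` with `c = 2^{-t}`, a weighted Cauchy–Schwarz
inequality (`QLHL.two_mul_trace_mul_le`) bounds `tr(U_s A_s)` by `tr σ` and the collision quantity
`tr(A_s σ^{-1/2} A_s σ^{-1/2})`. Summed over seeds and hash values, the latter is a quadratic form
in the blocks whose off-diagonal coefficients are nonpositive by universality
(`QLHL.sum_hashWeight_le`), and whose diagonal is controlled by `ρ'_x ≤ c σ`
(`QLHL.collision_self_le`). The seed distribution enters only through `P(r) ≤ 2^{-β}`, which turns
the sum over all `2^α` seeds into the factor `2^{α - β}`. A singular `σ` is replaced by `σ + δ`, and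
`δ → 0`.

The supremum defining the smooth min-entropy is reached by a limit over real exponents `t` below it
(`QLHL.ofReal_le_of_forall_lt`); this also covers the values `±∞`.
-/

namespace QLHL

open Matrix

noncomputable section

/-! ### Functions of a Hermitian matrix -/

section Spectral

variable {n : Type*} [Fintype n] [DecidableEq n]

/-- The matrix `g(A)` for a Hermitian matrix `A` and `g : ℝ → ℝ`: in an orthonormal eigenbasis
of `A`, the function `g` is applied to the eigenvalues. -/
def hermitianFun {A : Matrix n n ℂ} (hA : A.IsHermitian) (g : ℝ → ℝ) : Matrix n n ℂ :=
  (hA.eigenvectorUnitary : Matrix n n ℂ) * diagonal (fun i => ((g (hA.eigenvalues i) : ℝ) : ℂ)) *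
    star (hA.eigenvectorUnitary : Matrix n n ℂ)

variable {A : Matrix n n ℂ} (hA : A.IsHermitian)

lemma hermitianFun_id : hermitianFun hA (fun x => x) = A := by
  conv_rhs => rw [hA.spectral_theorem, Unitary.conjStarAlgAut_apply]
  rfl

lemma hermitianFun_one : hermitianFun hA (fun _ => 1) = 1 := by
  simp [hermitianFun]

lemma hermitianFun_add (g h : ℝ → ℝ) :
    hermitianFun hA (fun x => g x + h x) = hermitianFun hA g + hermitianFun hA h := by
  simp only [hermitianFun, ← add_mul, ← mul_add, diagonal_add, Complex.ofReal_add]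

lemma hermitianFun_sub (g h : ℝ → ℝ) :
    hermitianFun hA (fun x => g x - h x) = hermitianFun hA g - hermitianFun hA h := by
  simp only [hermitianFun, ← sub_mul, ← mul_sub, diagonal_sub, Complex.ofReal_sub]

lemma hermitianFun_mul (g h : ℝ → ℝ) :
    hermitianFun hA (fun x => g x * h x) = hermitianFun hA g * hermitianFun hA h := by
  have h1 : star (hA.eigenvectorUnitary : Matrix n n ℂ) *
      (hA.eigenvectorUnitary : Matrix n n ℂ) = 1 := Unitary.coe_star_mul_self _
  simp only [hermitianFun, Complex.ofReal_mul, ← diagonal_mul_diagonal, mul_assoc]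
  rw [← mul_assoc (star _) _ (_ * star _), h1, one_mul]

lemma hermitianFun_congr {g h : ℝ → ℝ} (H : ∀ i, g (hA.eigenvalues i) = h (hA.eigenvalues i)) :
    hermitianFun hA g = hermitianFun hA h := by
  simp only [hermitianFun, H]

lemma hermitianFun_posSemidef {g : ℝ → ℝ} (hg : ∀ i, 0 ≤ g (hA.eigenvalues i)) :
    (hermitianFun hA g).PosSemidef := by
  refine PosSemidef.mul_mul_conjTranspose_same (posSemidef_diagonal_iff.2 fun i => ?_) _
  exact_mod_cast hg i

lemma trace_hermitianFun (g : ℝ → ℝ) :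
    (hermitianFun hA g).trace.re = ∑ i, g (hA.eigenvalues i) := by
  have h1 : star (hA.eigenvectorUnitary : Matrix n n ℂ) *
      (hA.eigenvectorUnitary : Matrix n n ℂ) = 1 := Unitary.coe_star_mul_self _
  rw [hermitianFun, trace_mul_comm, ← mul_assoc, h1, one_mul, trace_diagonal]
  simp

lemma charpoly_hermitianFun (g : ℝ → ℝ) :
    (hermitianFun hA g).charpoly =
      (diagonal (fun i => ((g (hA.eigenvalues i) : ℝ) : ℂ))).charpoly := by
  have h1 : star (hA.eigenvectorUnitary : Matrix n n ℂ) *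
      (hA.eigenvectorUnitary : Matrix n n ℂ) = 1 := Unitary.coe_star_mul_self _
  rw [hermitianFun, charpoly_mul_comm, ← mul_assoc, h1, one_mul]

end Spectral

/-! ### The trace norm of a Hermitian matrix -/

section TraceNorm

variable {n : Type*} [Fintype n] [DecidableEq n]

lemma traceNorm_eq_sum_abs {A : Matrix n n ℂ} (hA : A.IsHermitian) :
    traceNorm A = ∑ i, |hA.eigenvalues i| := by
  have hsq : Aᴴ * A = hermitianFun hA (fun x => x * x) := by
    rw [hermitianFun_mul, hermitianFun_id, hA.eq]
  have h1 := (isHermitian_conjTranspose_mul_self A).roots_charpoly_eq_eigenvalues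
  have h2 : (Aᴴ * A).charpoly.roots = Multiset.map
      (fun i => ((hA.eigenvalues i * hA.eigenvalues i : ℝ) : ℂ)) Finset.univ.val := by
    rw [hsq, charpoly_hermitianFun, charpoly_diagonal]
    have := Polynomial.roots_multiset_prod_X_sub_C
      (Finset.univ.val.map fun i => ((hA.eigenvalues i * hA.eigenvalues i : ℝ) : ℂ))
    rwa [Multiset.map_map] at this
  rw [h2] at h1
  have h3 := congrArg (fun m : Multiset ℂ => (m.map fun z => Real.sqrt z.re).sum) h1
  simp only [Multiset.map_map, Function.comp_def, Complex.ofReal_re, Real.sqrt_mul_self_eq_abs]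
    at h3
  exact h3.symm

/-- The trace norm of a Hermitian matrix is attained as `tr(U A)` at the Hermitian contraction
`U = sign A`. -/
lemma exists_contraction_trace_eq {A : Matrix n n ℂ} (hA : A.IsHermitian) :
    ∃ U : Matrix n n ℂ, (1 - U).PosSemidef ∧ (1 + U).PosSemidef ∧
      (U * A).trace.re = traceNorm A := by
  let g : ℝ → ℝ := fun x => if 0 ≤ x then 1 else -1
  refine ⟨hermitianFun hA g, ?_, ?_, ?_⟩
  · rw [← hermitianFun_one hA, ← hermitianFun_sub]
    refine hermitianFun_posSemidef hA fun i => ?_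
    simp only [g]; split_ifs <;> norm_num
  · rw [← hermitianFun_one hA, ← hermitianFun_add]
    refine hermitianFun_posSemidef hA fun i => ?_
    simp only [g]; split_ifs <;> norm_num
  · have : hermitianFun hA g * A = hermitianFun hA (fun x => g x * x) := by
      rw [hermitianFun_mul, hermitianFun_id]
    rw [this, trace_hermitianFun, traceNorm_eq_sum_abs hA]
    refine Finset.sum_congr rfl fun i _ => ?_
    simp only [g]
    split_ifs with h
    · rw [abs_of_nonneg h, one_mul]
    · rw [abs_of_neg (not_le.1 h), neg_one_mul]

/-- The Jordan decomposition of a Hermitian matrix into its positive and negative parts. -/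
lemma exists_posSemidef_sub {A : Matrix n n ℂ} (hA : A.IsHermitian) :
    ∃ P N : Matrix n n ℂ, P.PosSemidef ∧ N.PosSemidef ∧ A = P - N ∧
      P.trace.re + N.trace.re = traceNorm A := by
  refine ⟨hermitianFun hA (fun x => max x 0), hermitianFun hA (fun x => max (-x) 0),
    hermitianFun_posSemidef hA fun i => le_max_right _ _,
    hermitianFun_posSemidef hA fun i => le_max_right _ _, ?_, ?_⟩
  · rw [← hermitianFun_sub]
    conv_lhs => rw [← hermitianFun_id hA]
    refine hermitianFun_congr hA fun i => ?_
    rcases le_total 0 (hA.eigenvalues i) with h | h <;> simp [h]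
  · rw [trace_hermitianFun, trace_hermitianFun, traceNorm_eq_sum_abs hA, ← Finset.sum_add_distrib]
    refine Finset.sum_congr rfl fun i _ => ?_
    rcases le_total 0 (hA.eigenvalues i) with h | h
    · simp [h, abs_of_nonneg h]
    · simp [h, abs_of_nonpos h]

end TraceNorm

/-! ### Trace inequalities -/

section TraceInequalities

variable {n : Type*} [Fintype n] [DecidableEq n]

lemma exists_posSemidef_mul_self_eq {P : Matrix n n ℂ} (hP : P.PosSemidef) :
    ∃ B : Matrix n n ℂ, B.PosSemidef ∧ B * B = P := by
  refine ⟨hermitianFun hP.1 Real.sqrt,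
    hermitianFun_posSemidef _ fun i => Real.sqrt_nonneg _, ?_⟩
  rw [← hermitianFun_mul]
  conv_rhs => rw [← hermitianFun_id hP.1]
  exact hermitianFun_congr _ fun i => Real.mul_self_sqrt (hP.eigenvalues_nonneg i)

lemma trace_re_nonneg {m : Type*} [Fintype m] {P : Matrix m m ℂ} (hP : P.PosSemidef) :
    0 ≤ P.trace.re :=
  (Complex.le_def.1 hP.trace_nonneg).1

lemma trace_mul_re_nonneg {P Q : Matrix n n ℂ} (hP : P.PosSemidef) (hQ : Q.PosSemidef) :
    0 ≤ (P * Q).trace.re := by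
  obtain ⟨B, hB, rfl⟩ := exists_posSemidef_mul_self_eq hP
  have h := hQ.mul_mul_conjTranspose_same B
  rw [hB.1.eq] at h
  rw [mul_assoc, trace_mul_comm]
  exact trace_re_nonneg h

lemma trace_mul_le_trace {U M : Matrix n n ℂ} (hU : (1 - U).PosSemidef) (hM : M.PosSemidef) :
    (U * M).trace.re ≤ M.trace.re := by
  have h := trace_mul_re_nonneg hU hM
  rw [sub_mul, one_mul, trace_sub, Complex.sub_re] at h
  linarith

lemma neg_trace_le_trace_mul {U M : Matrix n n ℂ} (hU : (1 + U).PosSemidef)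
    (hM : M.PosSemidef) : -M.trace.re ≤ (U * M).trace.re := by
  have h := trace_mul_re_nonneg hU hM
  rw [add_mul, one_mul, trace_add, Complex.add_re] at h
  linarith

/-- A weighted Cauchy–Schwarz inequality, in additive form. With `T = σ^{1/2}` it bounds `tr(U A)`,
for a Hermitian contraction `U`, by `tr σ` and the collision quantity
`tr(A σ^{-1/2} A σ^{-1/2})`. -/
lemma two_mul_trace_mul_le {T K U A : Matrix n n ℂ} (hT : T.PosSemidef) (hK : K.PosSemidef)
    (hTK : T * K = 1) (hU : (1 - U).PosSemidef) (hU' : (1 + U).PosSemidef)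
    (hA : A.IsHermitian) (t : ℝ) :
    2 * t * (U * A).trace.re ≤ t ^ 2 * (T * T).trace.re + (A * K * A * K).trace.re := by
  have hKT : K * T = 1 := mul_eq_one_comm.1 hTK
  have hUh : U.IsHermitian := by
    have := hU'.1.sub isHermitian_one
    simpa using this
  -- `tr(TUTU) ≤ tr(T²)`, from `tr((1 - U) T (1 + U) T) ≥ 0`
  have h1 : (T * U * T * U).trace.re ≤ (T * T).trace.re := by
    have h := hU'.mul_mul_conjTranspose_same T
    rw [hT.1.eq] at h
    have h := trace_mul_re_nonneg hU h
    have e : (1 - U) * (T * (1 + U) * T) =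
        T * T + T * U * T - U * (T * T) - U * (T * U * T) := by noncomm_ring
    have e1 : (T * U * T).trace = (U * (T * T)).trace := by
      rw [mul_assoc, trace_mul_comm, mul_assoc]
    rw [e, trace_sub, trace_sub, trace_add, e1, trace_mul_comm U (T * U * T)] at h
    simp only [Complex.sub_re, Complex.add_re] at h
    linarith
  -- `tr(X K X K) ≥ 0` for `X = t T U T - A`
  have hX : (((t : ℂ) • (T * U * T) - A)).IsHermitian := by
    refine IsHermitian.sub ?_ hA
    have : (T * U * T).IsHermitian := by
      have := isHermitian_mul_mul_conjTranspose T hUh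
      rwa [hT.1.eq] at this
    rw [IsHermitian, conjTranspose_smul, this.eq]
    simp
  have h2 : 0 ≤ (((t : ℂ) • (T * U * T) - A) * K * ((t : ℂ) • (T * U * T) - A) * K).trace.re := by
    refine trace_mul_re_nonneg ?_ hK
    have := hK.mul_mul_conjTranspose_same ((t : ℂ) • (T * U * T) - A)
    rwa [hX.eq] at this
  have e1 : T * U * T * K = T * U := by rw [mul_assoc, hTK, mul_one]
  have e : ((t : ℂ) • (T * U * T) - A) * K * ((t : ℂ) • (T * U * T) - A) * K =
      ((t : ℂ) ^ 2) • (T * U * T * U) - (t : ℂ) • (T * U * A * K) -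
        (t : ℂ) • (A * K * (T * U)) + A * K * A * K := by
    rw [mul_assoc, sub_mul, smul_mul_assoc, e1]
    simp only [sub_mul, mul_sub, smul_mul_assoc, mul_smul_comm, smul_sub, smul_smul, pow_two,
      mul_assoc]
    abel
  have e2 : (T * U * A * K).trace = (U * A).trace := by
    rw [trace_mul_comm, mul_assoc T, ← mul_assoc K, hKT, one_mul]
  have e3 : (A * K * (T * U)).trace = (U * A).trace := by
    rw [mul_assoc, ← mul_assoc K, hKT, one_mul, trace_mul_comm]
  rw [e, trace_add, trace_sub, trace_sub, trace_smul, trace_smul, trace_smul, e2, e3] at h2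
  have c2 : ((t : ℂ) ^ 2 * (T * U * T * U).trace).re = t ^ 2 * (T * U * T * U).trace.re := by
    rw [← Complex.ofReal_pow, Complex.re_ofReal_mul]
  simp only [smul_eq_mul, Complex.sub_re, Complex.add_re, Complex.re_ofReal_mul, c2] at h2
  nlinarith [mul_le_mul_of_nonneg_left h1 (sq_nonneg t)]

/-- For `0 ≤ M ≤ c σ` with `σ = T²`, the collision quantity of `M` is at most `c tr M`. -/
lemma collision_self_le {T K M : Matrix n n ℂ} (hK : K.PosSemidef) (hTK : T * K = 1)
    (hM : M.PosSemidef) {c : ℝ} (h : ((c : ℂ) • (T * T) - M).PosSemidef) :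
    (M * K * M * K).trace.re ≤ c * M.trace.re := by
  have hKT : K * T = 1 := mul_eq_one_comm.1 hTK
  have h1 := h.mul_mul_conjTranspose_same K
  rw [hK.1.eq] at h1
  have h2 := trace_mul_re_nonneg hM h1
  have e1 : K * (T * T) * K = 1 := by rw [← mul_assoc, hKT, one_mul, hTK]
  have e : M * (K * ((c : ℂ) • (T * T) - M) * K) = (c : ℂ) • M - M * K * M * K := by
    rw [mul_sub, sub_mul, mul_smul_comm, smul_mul_assoc, e1, mul_sub]
    simp [mul_assoc]
  rw [e, trace_sub, trace_smul, Complex.sub_re, smul_eq_mul, Complex.re_ofReal_mul] at h2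
  linarith

lemma collision_nonneg {K M N : Matrix n n ℂ} (hK : K.PosSemidef)
    (hM : M.PosSemidef) (hN : N.PosSemidef) : 0 ≤ (M * K * N * K).trace.re := by
  have h1 := hN.mul_mul_conjTranspose_same K
  rw [hK.1.eq] at h1
  have := trace_mul_re_nonneg hM h1
  simpa only [mul_assoc] using this

/-- A regularized density `σ + δ` has an invertible positive square root. -/
lemma exists_sqrt_add_smul_one {σ : Matrix n n ℂ} (hσ : σ.PosSemidef) {δ : ℝ} (hδ : 0 < δ) :
    ∃ T K : Matrix n n ℂ, T.PosSemidef ∧ K.PosSemidef ∧ T * K = 1 ∧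
      T * T = σ + (δ : ℂ) • 1 := by
  have hpos : ∀ i, 0 < hσ.1.eigenvalues i + δ := fun i =>
    add_pos_of_nonneg_of_pos (hσ.eigenvalues_nonneg i) hδ
  refine ⟨hermitianFun hσ.1 (fun x => Real.sqrt (x + δ)),
    hermitianFun hσ.1 (fun x => (Real.sqrt (x + δ))⁻¹),
    hermitianFun_posSemidef _ fun i => Real.sqrt_nonneg _,
    hermitianFun_posSemidef _ fun i => inv_nonneg.2 (Real.sqrt_nonneg _), ?_, ?_⟩
  · rw [← hermitianFun_mul, ← hermitianFun_one hσ.1]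
    exact hermitianFun_congr _ fun i => mul_inv_cancel₀ (Real.sqrt_pos.2 (hpos i)).ne'
  · rw [← hermitianFun_mul, hermitianFun_congr hσ.1 (h := fun x => x + δ * 1)
      fun i => by rw [Real.mul_self_sqrt (hpos i).le, mul_one], hermitianFun_add, hermitianFun_id]
    congr 1
    simp only [hermitianFun, mul_one]
    have h2 : (hσ.1.eigenvectorUnitary : Matrix n n ℂ) *
      star (hσ.1.eigenvectorUnitary : Matrix n n ℂ) = 1 := Unitary.coe_mul_star_self _
    rw [← smul_one_eq_diagonal, mul_smul_comm, mul_one, smul_mul_assoc, h2]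

end TraceInequalities

/-! ### Block-diagonal operators and hashing -/

section Blocks

variable {X E : Type*}

/-- The diagonal block `⟨x| M |x⟩` of an operator on `ℂ^X ⊗ ℂ^E`. -/
def diagBlock (M : Matrix (X × E) (X × E) ℂ) (x : X) : Matrix E E ℂ :=
  M.submatrix (Prod.mk x) (Prod.mk x)

lemma trace_eq_sum_diagBlock [Fintype X] [Fintype E]
    (M : Matrix (X × E) (X × E) ℂ) : M.trace = ∑ x, (diagBlock M x).trace := by
  simp [trace, Fintype.sum_prod_type, diagBlock]

variable [Fintype X] [DecidableEq X]

lemma cqOperator_apply (τ : X → Matrix E E ℂ)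
    (p q : X × E) : cqOperator τ p q = if p.1 = q.1 then τ p.1 p.2 q.2 else 0 := by
  simp only [cqOperator, Matrix.sum_apply, kroneckerMap_apply, Matrix.single_apply, ite_mul,
    one_mul, zero_mul, ite_and]
  rw [Finset.sum_ite_eq' Finset.univ p.1]
  simp

lemma cqOperator_isHermitian {τ : X → Matrix E E ℂ}
    (hτ : ∀ x, (τ x).IsHermitian) : (cqOperator τ).IsHermitian := by
  refine IsHermitian.ext fun p q => ?_
  simp only [cqOperator_apply, eq_comm (a := q.1)]
  split_ifs with h
  · rw [← h, (hτ p.1).apply]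
  · simp

lemma diagBlock_cqOperator (τ : X → Matrix E E ℂ)
    (x : X) : diagBlock (cqOperator τ) x = τ x := by
  ext e e'
  simp [diagBlock, cqOperator_apply]

lemma trace_mul_cqOperator [Fintype E]
    (U : Matrix (X × E) (X × E) ℂ) (τ : X → Matrix E E ℂ) :
    (U * cqOperator τ).trace = ∑ x, (diagBlock U x * τ x).trace := by
  simp only [trace, diag_apply, mul_apply, Fintype.sum_prod_type, cqOperator_apply, diagBlock,
    submatrix_apply, mul_ite, mul_zero]
  refine Finset.sum_congr rfl fun x _ => Finset.sum_congr rfl fun e _ => ?_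
  rw [Finset.sum_comm]
  simp

end Blocks

section Hashing

variable {X S E : Type*} [Fintype X] [Fintype S] [DecidableEq S]

/-- The coefficient of the input `x` in the deviation from uniformity of the hash value `s`. -/
def hashWeight {X S : Type*} [Fintype S] [DecidableEq S] (f : X → S) (s : S) (x : X) : ℝ :=
  (if f x = s then 1 else 0) - (Fintype.card S : ℝ)⁻¹

/-- The block `ρ_E^[f,s] - ρ_E / |S|` of the operator `ρ_{SE} - ω_S ⊗ ρ_E`, written as a linear
combination of the blocks of `ρ_{XE}`. -/
def deviation (f : X → S) (M : X → Matrix E E ℂ) (s : S) : Matrix E E ℂ :=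
  ∑ x, (hashWeight f s x : ℂ) • M x

lemma deviation_eq
    (f : X → S) (M : X → Matrix E E ℂ) (s : S) :
    deviation f M s = hashed f M s - (Fintype.card S : ℂ)⁻¹ • ∑ x, M x := by
  simp only [deviation, hashWeight, hashed, Complex.ofReal_sub, sub_smul, Finset.sum_sub_distrib,
    Finset.smul_sum, Finset.sum_filter]
  congr 1
  · refine Finset.sum_congr rfl fun x _ => ?_
    split_ifs <;> simp
  · simp

lemma sum_hashed
    (f : X → S) (M : X → Matrix E E ℂ) : ∑ s, hashed f M s = ∑ x, M x := by
  simp only [hashed]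
  exact Finset.sum_fiberwise _ _ _

lemma hashed_sub_uniform (f : X → S) (M : X → Matrix E E ℂ) :
    cqOperator (hashed f M) - ((Fintype.card S : ℂ)⁻¹ • (1 : Matrix S S ℂ)) ⊗ₖ
      partialTrace (cqOperator (hashed f M)) = cqOperator (deviation f M) := by
  have h : partialTrace (cqOperator (hashed f M)) = ∑ x, M x := by
    rw [← sum_hashed f M]
    ext e e'
    simp [partialTrace, cqOperator_apply, Matrix.sum_apply]
  rw [h]
  ext p q
  simp only [Matrix.sub_apply, kroneckerMap_apply, cqOperator_apply, deviation_eq,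
    Matrix.smul_apply, one_apply]
  split_ifs <;> simp

lemma deviation_isHermitian
    (f : X → S) {M : X → Matrix E E ℂ} (hM : ∀ x, (M x).IsHermitian)
    (s : S) : (deviation f M s).IsHermitian := by
  rw [IsHermitian, deviation, conjTranspose_sum]
  refine Finset.sum_congr rfl fun x _ => ?_
  rw [conjTranspose_smul, (hM x).eq]
  simp

lemma deviation_add_sub
    (f : X → S) (M P N : X → Matrix E E ℂ) (s : S) :
    deviation f (fun x => M x + P x - N x) s =
      deviation f M s + deviation f P s - deviation f N s := by
  simp only [deviation, smul_add, smul_sub, Finset.sum_add_distrib, Finset.sum_sub_distrib]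

lemma trace_hashed_sum {X S E : Type*} [Fintype X] [Fintype S] [DecidableEq S] [Fintype E]
    (f : X → S) (M : X → Matrix E E ℂ) :
    ∑ s, (hashed f M s).trace.re = ∑ x, (M x).trace.re := by
  simp only [← Complex.re_sum, ← trace_sum, sum_hashed]

/-- Hashing and discarding the classical register are positive and trace preserving, so for
positive blocks `M` the deviation pairs with contractions to at most `2 tr M`. -/
lemma abs_trace_mul_deviation_le [Nonempty S] [Fintype E] [DecidableEq E]
    (f : X → S) {U : S → Matrix E E ℂ}
    (hU : ∀ s, (1 - U s).PosSemidef) (hU' : ∀ s, (1 + U s).PosSemidef)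
    {M : X → Matrix E E ℂ} (hM : ∀ x, (M x).PosSemidef) :
    |∑ s, (U s * deviation f M s).trace.re| ≤ 2 * ∑ x, (M x).trace.re := by
  have hpos : ∀ s, (hashed f M s).PosSemidef := fun s =>
    posSemidef_sum _ fun x _ => hM x
  have hsum : (∑ x, M x).PosSemidef := posSemidef_sum _ fun x _ => hM x
  have hcard : (0 : ℝ) < Fintype.card S := by exact_mod_cast Fintype.card_pos
  have key : ∀ s, (U s * deviation f M s).trace.re = (U s * hashed f M s).trace.re -
      (Fintype.card S : ℝ)⁻¹ * (U s * ∑ x, M x).trace.re := by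
    intro s
    rw [deviation_eq, mul_sub, mul_smul_comm, trace_sub, trace_smul, Complex.sub_re, smul_eq_mul,
      ← Complex.ofReal_natCast, ← Complex.ofReal_inv, Complex.re_ofReal_mul]
  have bound : ∀ s, |(U s * deviation f M s).trace.re| ≤ (hashed f M s).trace.re +
      (Fintype.card S : ℝ)⁻¹ * ∑ x, (M x).trace.re := by
    intro s
    have e : (∑ x, M x).trace.re = ∑ x, (M x).trace.re := by rw [trace_sum, Complex.re_sum]
    have a1 := trace_mul_le_trace (hU s) (hpos s)
    have a2 := neg_trace_le_trace_mul (hU' s) (hpos s)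
    have b1 := mul_le_mul_of_nonneg_left (trace_mul_le_trace (hU s) hsum) (inv_pos.2 hcard).le
    have b2 := mul_le_mul_of_nonneg_left (neg_trace_le_trace_mul (hU' s) hsum) (inv_pos.2 hcard).le
    rw [← e, key, abs_le]
    constructor <;> linarith
  calc _ ≤ ∑ s, |(U s * deviation f M s).trace.re| := Finset.abs_sum_le_sum_abs _ _
    _ ≤ ∑ s, ((hashed f M s).trace.re + (Fintype.card S : ℝ)⁻¹ * ∑ x, (M x).trace.re) :=
        Finset.sum_le_sum fun s _ => bound s
    _ = 2 * ∑ x, (M x).trace.re := by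
        rw [Finset.sum_add_distrib, trace_hashed_sum, Finset.sum_const, Finset.card_univ,
          nsmul_eq_mul, mul_inv_cancel_left₀ hcard.ne', two_mul]

end Hashing

/-! ### Collision counting for universal families -/

section Collisions

variable {R X S E : Type*} [Fintype R] [Fintype X] [Fintype S] [DecidableEq S] [Fintype E]

lemma sum_hashWeight_mul {X S : Type*} [Fintype S] [DecidableEq S] [Nonempty S]
    (f : X → S) (x y : X) :
    ∑ s, hashWeight f s x * hashWeight f s y =
      (if f x = f y then 1 else 0) - (Fintype.card S : ℝ)⁻¹ := by
  have hcard : (Fintype.card S : ℝ) ≠ 0 := by exact_mod_cast Fintype.card_ne_zero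
  simp only [hashWeight, sub_mul, mul_sub, Finset.sum_sub_distrib, ← Finset.mul_sum,
    ite_mul, one_mul, zero_mul, Finset.sum_ite_eq, Finset.mem_univ, if_true,
    Finset.sum_const, Finset.card_univ, nsmul_eq_mul, mul_inv_cancel₀ hcard]
  rw [if_congr (eq_comm (a := f y) (b := f x)) rfl rfl]
  ring

/-- Universality enters here: for a nonnegative kernel `q`, only its diagonal contributes to the
summed deviation from uniformity. -/
lemma sum_hashWeight_le [Nonempty R] [Nonempty S] {f : R → X → S} (hf : IsUniversalFamily f)
    {q : X → X → ℝ} (hq : ∀ x y, 0 ≤ q x y) :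
    ∑ r, ∑ s, ∑ x, ∑ y, hashWeight (f r) s x * hashWeight (f r) s y * q x y ≤
      Fintype.card R * ∑ x, q x x := by
  classical
  have hR : (0 : ℝ) < Fintype.card R := by exact_mod_cast Fintype.card_pos
  have hS : (0 : ℝ) < Fintype.card S := by exact_mod_cast Fintype.card_pos
  have coeff : ∀ x y, (∑ r, ∑ s, hashWeight (f r) s x * hashWeight (f r) s y) ≤
      if x = y then (Fintype.card R : ℝ) else 0 := by
    intro x y
    simp only [sum_hashWeight_mul, Finset.sum_sub_distrib, Finset.sum_const, Finset.card_univ,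
      nsmul_eq_mul]
    split_ifs with h
    · subst h
      simp only [if_true, Finset.sum_const, Finset.card_univ, nsmul_eq_mul, mul_one]
      have : 0 < (Fintype.card R : ℝ) * (Fintype.card S : ℝ)⁻¹ := by positivity
      linarith
    · have := hf x y h
      rw [div_le_iff₀ hR, one_div, mul_comm] at this
      rw [← Finset.sum_filter, Finset.sum_const, nsmul_eq_mul, mul_one]
      linarith
  calc _ = ∑ x, ∑ y, (∑ r, ∑ s, hashWeight (f r) s x * hashWeight (f r) s y) * q x y := by
        simp only [Finset.sum_mul]
        rw [Finset.sum_congr rfl fun r _ => Finset.sum_comm, Finset.sum_comm]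
        refine Finset.sum_congr rfl fun x _ => ?_
        rw [Finset.sum_congr rfl fun r _ => Finset.sum_comm, Finset.sum_comm]
    _ ≤ ∑ x, ∑ y, (if x = y then (Fintype.card R : ℝ) else 0) * q x y :=
        Finset.sum_le_sum fun x _ => Finset.sum_le_sum fun y _ =>
          mul_le_mul_of_nonneg_right (coeff x y) (hq x y)
    _ = Fintype.card R * ∑ x, q x x := by
        simp [Finset.mul_sum]

lemma collision_deviation_eq
    (f : X → S) (M : X → Matrix E E ℂ) (K : Matrix E E ℂ) (s : S) :
    (deviation f M s * K * deviation f M s * K).trace.re =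
      ∑ x, ∑ y, hashWeight f s x * hashWeight f s y * (M x * K * M y * K).trace.re := by
  simp only [deviation, Finset.sum_mul, Finset.mul_sum, trace_sum, Complex.re_sum, smul_mul_assoc,
    mul_smul_comm, trace_smul, smul_eq_mul, Complex.re_ofReal_mul]
  rw [Finset.sum_comm]
  refine Finset.sum_congr rfl fun x _ => Finset.sum_congr rfl fun y _ => ?_
  ring

/-- The leftover hash bound for blocks satisfying `M x ≤ c σ`, in dual form: the trace norms are
replaced by pairings with contractions `U r s`. -/
lemma sum_trace_mul_deviation_le [DecidableEq E] [Nonempty R] [Nonempty S] {f : R → X → S}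
    (hf : IsUniversalFamily f) {U : R → S → Matrix E E ℂ}
    (hU : ∀ r s, (1 - U r s).PosSemidef) (hU' : ∀ r s, (1 + U r s).PosSemidef)
    {M : X → Matrix E E ℂ} (hM : ∀ x, (M x).PosSemidef) (hM1 : ∑ x, (M x).trace.re ≤ 1)
    {σ : Matrix E E ℂ} (hσ : IsDensity σ) {c : ℝ} (hc : 0 < c)
    (hMσ : ∀ x, ((c : ℂ) • σ - M x).PosSemidef)
    {p : R → ℝ} (hp : ∀ r, 0 ≤ p r) {b : ℝ} (hpb : ∀ r, p r ≤ b) :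
    ∑ r, p r * ∑ s, (U r s * deviation (f r) M s).trace.re ≤
      b * Fintype.card R * Real.sqrt (c * Fintype.card S) := by
  have hS : (0 : ℝ) < Fintype.card S := by exact_mod_cast Fintype.card_pos
  have hb : 0 ≤ b := (hp (Classical.arbitrary R)).trans (hpb _)
  -- the weight balancing the two terms of the additive Cauchy–Schwarz inequality
  set t : ℝ := Real.sqrt (c / Fintype.card S) with ht
  have ht0 : 0 < t := Real.sqrt_pos.2 (by positivity)
  have ht2 : t ^ 2 * Fintype.card S = c := by
    rw [ht, Real.sq_sqrt (by positivity)]; field_simp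
  have htc : t * Real.sqrt (c * Fintype.card S) = c := by
    rw [ht, ← Real.sqrt_mul (by positivity), Real.sqrt_eq_iff_mul_self_eq (by positivity) hc.le]
    field_simp
  set L : ℝ := ∑ r, p r * ∑ s, (U r s * deviation (f r) M s).trace.re with hL
  have main : ∀ δ : ℝ, 0 < δ →
      2 * t * L ≤ b * Fintype.card R * c * (2 + δ * Fintype.card E) := by
    intro δ hδ
    obtain ⟨T, K, hT, hK, hTK, hTT⟩ := exists_sqrt_add_smul_one hσ.1 hδ
    have htr : (T * T).trace.re = 1 + δ * Fintype.card E := by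
      rw [hTT, trace_add, hσ.2, trace_smul, trace_one]
      simp
    have hMT : ∀ x, ((c : ℂ) • (T * T) - M x).PosSemidef := by
      intro x
      have h1 : ((c * δ : ℝ) : ℂ) • (1 : Matrix E E ℂ) =
          (c : ℂ) • (T * T) - M x - ((c : ℂ) • σ - M x) := by
        rw [hTT, smul_add, smul_smul, Complex.ofReal_mul]; abel
      have h2 : (((c * δ : ℝ) : ℂ) • (1 : Matrix E E ℂ)).PosSemidef :=
        PosSemidef.one.smul (by exact_mod_cast (mul_pos hc hδ).le)
      have h3 := (hMσ x).add h2
      rw [h1] at h3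
      simpa using h3
    have hterm : ∀ r s, 2 * t * (U r s * deviation (f r) M s).trace.re ≤
        t ^ 2 * (T * T).trace.re +
          (deviation (f r) M s * K * deviation (f r) M s * K).trace.re := fun r s =>
      two_mul_trace_mul_le hT hK hTK (hU r s) (hU' r s)
        (deviation_isHermitian _ (fun x => (hM x).1) s) t
    have hQ : ∀ r s, 0 ≤ (deviation (f r) M s * K * deviation (f r) M s * K).trace.re := by
      intro r s
      refine trace_mul_re_nonneg ?_ hK
      have := hK.mul_mul_conjTranspose_same (deviation (f r) M s)
      rwa [(deviation_isHermitian _ (fun x => (hM x).1) s).eq] at this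
    have hcoll : ∑ r, ∑ s, (deviation (f r) M s * K * deviation (f r) M s * K).trace.re ≤
        Fintype.card R * c := by
      simp only [collision_deviation_eq]
      refine (sum_hashWeight_le hf fun x y => collision_nonneg hK (hM x) (hM y)).trans ?_
      refine mul_le_mul_of_nonneg_left ?_ (Nat.cast_nonneg _)
      calc _ ≤ ∑ x, c * (M x).trace.re :=
            Finset.sum_le_sum fun x _ => collision_self_le hK hTK (hM x) (hMT x)
        _ ≤ c := by rw [← Finset.mul_sum]; exact mul_le_of_le_one_right hc.le hM1
    calc 2 * t * L = ∑ r, p r * ∑ s, 2 * t * (U r s * deviation (f r) M s).trace.re := by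
          rw [hL, Finset.mul_sum]
          refine Finset.sum_congr rfl fun r _ => ?_
          rw [← Finset.mul_sum]; ring
      _ ≤ ∑ r, b * ∑ s, (t ^ 2 * (T * T).trace.re +
            (deviation (f r) M s * K * deviation (f r) M s * K).trace.re) := by
          refine Finset.sum_le_sum fun r _ => ?_
          refine (mul_le_mul_of_nonneg_left (Finset.sum_le_sum fun s _ => hterm r s) (hp r)).trans ?_
          refine mul_le_mul_of_nonneg_right (hpb r) (Finset.sum_nonneg fun s _ => ?_)
          refine add_nonneg (mul_nonneg (sq_nonneg t) ?_) (hQ r s)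
          rw [htr]; positivity
      _ = b * (Fintype.card R * (t ^ 2 * Fintype.card S) * (1 + δ * Fintype.card E) +
            ∑ r, ∑ s, (deviation (f r) M s * K * deviation (f r) M s * K).trace.re) := by
          rw [← Finset.mul_sum]
          simp only [Finset.sum_add_distrib, Finset.sum_const, Finset.card_univ, nsmul_eq_mul, htr]
          ring
      _ ≤ b * (Fintype.card R * c * (1 + δ * Fintype.card E) + Fintype.card R * c) := by
          rw [ht2]
          gcongr
      _ = b * Fintype.card R * c * (2 + δ * Fintype.card E) := by ring
  have hlim : 2 * t * L ≤ b * Fintype.card R * c * (2 + 0 * Fintype.card E) := by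
    have hcont : Filter.Tendsto (fun δ : ℝ => b * Fintype.card R * c * (2 + δ * Fintype.card E))
        (nhdsWithin 0 (Set.Ioi 0)) (nhds (b * Fintype.card R * c * (2 + 0 * Fintype.card E))) :=
      ((by fun_prop : Continuous fun δ : ℝ =>
        b * Fintype.card R * c * (2 + δ * Fintype.card E)).tendsto 0).mono_left nhdsWithin_le_nhds
    exact ge_of_tendsto hcont (Filter.eventually_of_mem self_mem_nhdsWithin fun δ hδ => main δ hδ)
  refine le_of_mul_le_mul_left ?_ (mul_pos two_pos ht0)
  calc 2 * t * L ≤ b * Fintype.card R * c * (2 + 0 * Fintype.card E) := hlim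
    _ = 2 * t * (b * Fintype.card R * Real.sqrt (c * Fintype.card S)) := by
      linear_combination (-2 * b * Fintype.card R) * htc

end Collisions

/-! ### The leftover hash lemma at a fixed approximating operator -/

lemma prob_le_of_le_minEntropy {Ω : Type*} [Fintype Ω] (P : PMF Ω) {β : ℝ}
    (hP : β ≤ minEntropy P) (r : Ω) : (P r).toReal ≤ (2 : ℝ) ^ (-β) := by
  have hbdd : BddAbove (Set.range fun r => (P r).toReal) := Set.finite_range _ |>.bddAbove
  obtain ⟨r₀, hr₀⟩ := P.support_nonempty
  have hpos : 0 < ⨆ r, (P r).toReal :=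
    (ENNReal.toReal_pos ((P.mem_support_iff r₀).1 hr₀) (P.apply_ne_top r₀)).trans_le
      (le_ciSup hbdd r₀)
  have h : Real.logb 2 (⨆ r, (P r).toReal) ≤ -β := by
    rw [minEntropy] at hP; linarith
  exact (le_ciSup hbdd r).trans ((Real.logb_le_iff_le_rpow one_lt_two hpos).1 h)

lemma sum_prob_toReal {Ω : Type*} [Fintype Ω] (P : PMF Ω) : ∑ r, (P r).toReal = 1 := by
  rw [← ENNReal.toReal_sum fun r _ => P.apply_ne_top r, ← tsum_fintype (L := .unconditional _),
    P.tsum_coe, ENNReal.toReal_one]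

section Main

variable {X S E : Type*} [Fintype X] [DecidableEq X] [Fintype S] [DecidableEq S]
  [Fintype E] [DecidableEq E]

/-- The bound for one operator `ρ'` admissible in the smooth min-entropy, together with one
density operator `σ` and one exponent `t` admissible in `H_min(ρ'|E)`. -/
lemma sum_prob_mul_distFromUniform_le
    {α : ℕ} {β l : ℝ} (hl : (Fintype.card S : ℝ) = (2 : ℝ) ^ l)
    {f : (Fin α → Bool) → X → S} (hf : IsUniversalFamily f)
    {P : PMF (Fin α → Bool)} (hP : β ≤ minEntropy P)
    {ρ : X → Matrix E E ℂ} (hρ : ∀ x, (ρ x).PosSemidef) (hρ1 : ∑ x, (ρ x).trace = 1)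
    {ε : ℝ} {ρ' : Matrix (X × E) (X × E) ℂ} (hρ' : ρ'.PosSemidef)
    (htr : ρ'.trace.re ≤ (cqOperator ρ).trace.re)
    (hdist : traceNorm (cqOperator ρ - ρ') ≤ ε * (cqOperator ρ).trace.re)
    {t : ℝ} {σ : Matrix E E ℂ} (hσ : IsDensity σ)
    (ht : ((((2 : ℝ) ^ (-t) : ℝ) : ℂ) • ((1 : Matrix X X ℂ) ⊗ₖ σ) - ρ').PosSemidef) :
    ∑ r, (P r).toReal * distFromUniform (cqOperator (hashed (f r) ρ)) ≤
      1 / 2 * (2 : ℝ) ^ ((α : ℝ) - β) * (2 : ℝ) ^ (-(1 / 2) * (t - l)) + ε := by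
  have hSpos : (0 : ℝ) < Fintype.card S := by rw [hl]; positivity
  have : Nonempty S := Fintype.card_pos_iff.1 (by exact_mod_cast hSpos)
  have htrρ : (cqOperator ρ).trace.re = 1 := by
    rw [trace_eq_sum_diagBlock]
    simp only [diagBlock_cqOperator, hρ1, Complex.one_re]
  rw [htrρ] at htr hdist
  rw [mul_one] at hdist
  obtain ⟨Q, N, hQ, hN, hQN, hQNtr⟩ := exists_posSemidef_sub
    ((cqOperator_isHermitian fun x => (hρ x).1).sub hρ'.1)
  have hsplit : ρ = fun x => diagBlock ρ' x + diagBlock Q x - diagBlock N x := by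
    funext x
    have h : cqOperator ρ = ρ' + Q - N := by rw [add_sub_assoc, ← hQN]; abel
    rw [← diagBlock_cqOperator ρ x, h]
    rfl
  choose U hU hU' hUtr using fun r => exists_contraction_trace_eq
    (cqOperator_isHermitian fun s =>
      deviation_isHermitian (f r) (fun x => (hρ x).1) s)
  have hUs : ∀ r s, (1 - diagBlock (U r) s).PosSemidef := by
    intro r s
    have := (hU r).submatrix (Prod.mk s)
    rwa [submatrix_sub, Pi.sub_apply, Pi.sub_apply,
      submatrix_one _ (Prod.mk_right_injective s)] at this
  have hUs' : ∀ r s, (1 + diagBlock (U r) s).PosSemidef := by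
    intro r s
    have := (hU' r).submatrix (Prod.mk s)
    rwa [submatrix_add, Pi.add_apply, Pi.add_apply,
      submatrix_one _ (Prod.mk_right_injective s)] at this
  have hD : ∀ r, distFromUniform (cqOperator (hashed (f r) ρ)) ≤
      1 / 2 * ∑ s, (diagBlock (U r) s * deviation (f r) (diagBlock ρ') s).trace.re + ε := by
    intro r
    have hQb := abs_trace_mul_deviation_le (f r) (hUs r) (hUs' r) (M := diagBlock Q)
      (fun x => hQ.submatrix (Prod.mk x))
    have hNb := abs_trace_mul_deviation_le (f r) (hUs r) (hUs' r) (M := diagBlock N)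
      (fun x => hN.submatrix (Prod.mk x))
    rw [trace_eq_sum_diagBlock, trace_eq_sum_diagBlock N, Complex.re_sum, Complex.re_sum] at hQNtr
    have e : ∀ s, (diagBlock (U r) s * deviation (f r) ρ s).trace.re =
        (diagBlock (U r) s * deviation (f r) (diagBlock ρ') s).trace.re +
        (diagBlock (U r) s * deviation (f r) (diagBlock Q) s).trace.re -
        (diagBlock (U r) s * deviation (f r) (diagBlock N) s).trace.re := by
      intro s
      rw [hsplit, deviation_add_sub, mul_sub, mul_add, trace_sub, trace_add, Complex.sub_re,
        Complex.add_re]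
    rw [distFromUniform, hashed_sub_uniform, ← hUtr r, trace_mul_cqOperator, Complex.re_sum,
      Finset.sum_congr rfl fun s _ => e s, Finset.sum_sub_distrib, Finset.sum_add_distrib]
    have h1 := (abs_le.1 hQb).2
    have h2 := (abs_le.1 hNb).1
    linarith
  have hblock : ∀ x, ((((2 : ℝ) ^ (-t) : ℝ) : ℂ) • σ - diagBlock ρ' x).PosSemidef := by
    intro x
    have h := ht.submatrix (Prod.mk x)
    have e : ((((2 : ℝ) ^ (-t) : ℝ) : ℂ) • ((1 : Matrix X X ℂ) ⊗ₖ σ) - ρ').submatrix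
        (Prod.mk x) (Prod.mk x) = (((2 : ℝ) ^ (-t) : ℝ) : ℂ) • σ - diagBlock ρ' x := by
      ext i j
      simp [diagBlock]
    rwa [e] at h
  have hcore := sum_trace_mul_deviation_le hf hUs hUs' (M := diagBlock ρ')
    (fun x => hρ'.submatrix (Prod.mk x))
    (by rwa [trace_eq_sum_diagBlock, Complex.re_sum] at htr) hσ
    (Real.rpow_pos_of_pos two_pos (-t)) hblock (fun r => ENNReal.toReal_nonneg)
    (prob_le_of_le_minEntropy P hP)
  have hpow : (2 : ℝ) ^ (-β) * Fintype.card (Fin α → Bool) *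
      Real.sqrt ((2 : ℝ) ^ (-t) * Fintype.card S) =
        (2 : ℝ) ^ ((α : ℝ) - β) * (2 : ℝ) ^ (-(1 / 2) * (t - l)) := by
    rw [hl, ← Real.rpow_add two_pos, Real.sqrt_eq_rpow, ← Real.rpow_mul two_pos.le]
    have : (Fintype.card (Fin α → Bool) : ℝ) = (2 : ℝ) ^ (α : ℝ) := by simp
    rw [this, ← Real.rpow_add two_pos]
    congr 2 <;> ring
  calc _ ≤ ∑ r, (P r).toReal *
        (1 / 2 * ∑ s, (diagBlock (U r) s * deviation (f r) (diagBlock ρ') s).trace.re + ε) :=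
        Finset.sum_le_sum fun r _ => mul_le_mul_of_nonneg_left (hD r) ENNReal.toReal_nonneg
    _ = 1 / 2 * ∑ r, (P r).toReal *
          ∑ s, (diagBlock (U r) s * deviation (f r) (diagBlock ρ') s).trace.re + ε := by
        simp only [mul_add, Finset.sum_add_distrib, ← Finset.sum_mul, sum_prob_toReal, one_mul]
        rw [Finset.mul_sum]
        congr 1
        exact Finset.sum_congr rfl fun r _ => by ring
    _ ≤ _ := by
        rw [hpow] at hcore
        linarith

end Main

/-! ### Passage to the supremum -/

lemma twoPow_coe (x : ℝ) : twoPow (x : EReal) = ENNReal.ofReal ((2 : ℝ) ^ x) := by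
  rw [twoPow, ← EReal.coe_mul, EReal.exp_coe, Real.rpow_def_of_pos two_pos, mul_comm]

lemma twoPow_top : twoPow ⊤ = ⊤ := by
  rw [twoPow, EReal.top_mul_coe_of_pos (Real.log_pos one_lt_two), EReal.exp_top]

lemma exists_of_lt_smoothCondMinEntropy {A E : Type*} [Fintype A] [DecidableEq A] [Fintype E]
    [DecidableEq E] {ε : ℝ} {ρ : Matrix (A × E) (A × E) ℂ} {h : EReal}
    (hh : h < smoothCondMinEntropy ε ρ) :
    ∃ ρ' : Matrix (A × E) (A × E) ℂ, ρ'.PosSemidef ∧ ρ'.trace.re ≤ ρ.trace.re ∧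
      traceNorm (ρ - ρ') ≤ ε * ρ.trace.re ∧ ∃ (t : ℝ) (σ : Matrix E E ℂ), IsDensity σ ∧
        ((((2 : ℝ) ^ (-t) : ℝ) : ℂ) • ((1 : Matrix A A ℂ) ⊗ₖ σ) - ρ').PosSemidef ∧
        h < (t : EReal) := by
  obtain ⟨_, ⟨ρ', h1, h2, h3, rfl⟩, hlt⟩ := lt_sSup_iff.1 hh
  obtain ⟨_, ⟨t, σ, h4, h5, rfl⟩, hlt'⟩ := lt_sSup_iff.1 hlt
  exact ⟨ρ', h1, h2, h3, t, σ, h4, h5, hlt'⟩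

/-- A bound `a ≤ C 2^{-(t - l)/2} + ε` for all real `t < H` passes to the limit `t → H`, for an
extended real `H`. -/
lemma ofReal_le_of_forall_lt {a C l ε : ℝ} (hC : 0 < C) (hε : 0 ≤ ε) (H : EReal)
    (h : ∀ t : ℝ, (t : EReal) < H → a ≤ C * (2 : ℝ) ^ (-(1 / 2) * (t - l)) + ε) :
    ENNReal.ofReal a ≤ ENNReal.ofReal C *
      twoPow (((-(1 / 2) : ℝ) : EReal) * (H - (l : EReal))) + ENNReal.ofReal ε := by
  have hneg : (-(1 / 2) : ℝ) < 0 := by norm_num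
  have hcont : Continuous fun t : ℝ => C * (2 : ℝ) ^ (-(1 / 2) * (t - l)) + ε := by
    have : (2 : ℝ) ≠ 0 := two_ne_zero
    fun_prop (disch := exact fun _ => Or.inl this)
  induction H with
  | bot =>
    rw [EReal.bot_sub, EReal.coe_mul_bot_of_neg hneg, twoPow_top,
      ENNReal.mul_top (ENNReal.ofReal_pos.2 hC).ne', top_add]
    exact le_top
  | coe H =>
    have hlim : a ≤ C * (2 : ℝ) ^ (-(1 / 2) * (H - l)) + ε :=
      ge_of_tendsto ((hcont.tendsto H).mono_left nhdsWithin_le_nhds)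
        (Filter.eventually_of_mem (self_mem_nhdsWithin (s := Set.Iio H))
          fun t ht => h t (EReal.coe_lt_coe_iff.2 ht))
    rw [← EReal.coe_sub, ← EReal.coe_mul, twoPow_coe, ← ENNReal.ofReal_mul hC.le,
      ← ENNReal.ofReal_add (by positivity) hε]
    exact ENNReal.ofReal_le_ofReal hlim
  | top =>
    have hlim : Filter.Tendsto (fun t : ℝ => C * (2 : ℝ) ^ (-(1 / 2) * (t - l)) + ε)
        Filter.atTop (nhds (C * 0 + ε)) := by
      refine Filter.Tendsto.add_const _ (Filter.Tendsto.const_mul _ ?_)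
      refine (tendsto_rpow_atBot_of_base_gt_one 2 one_lt_two).comp ?_
      exact (Filter.tendsto_atTop_add_const_right _ (-l) Filter.tendsto_id).const_mul_atTop_of_neg
        hneg
    have ha : a ≤ C * 0 + ε := ge_of_tendsto' hlim fun t => h t (EReal.coe_lt_top t)
    rw [mul_zero, zero_add] at ha
    exact (ENNReal.ofReal_le_ofReal ha).trans le_add_self

end

end QLHL

theorem theorem1 {X S E : Type*} [Fintype X] [DecidableEq X] [Fintype S] [DecidableEq S]
    [Fintype E] [DecidableEq E]
    (α : ℕ) (β l : ℝ) (hl : (Fintype.card S : ℝ) = (2 : ℝ) ^ l)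
    (f : (Fin α → Bool) → X → S) (hf : QLHL.IsUniversalFamily f)
    (P : PMF (Fin α → Bool)) (hP : β ≤ QLHL.minEntropy P)
    (ρ : X → Matrix E E ℂ) (hρ : ∀ x, (ρ x).PosSemidef) (hρ1 : ∑ x, (ρ x).trace = 1)
    (ε : ℝ) (hε : 0 ≤ ε) :
    ENNReal.ofReal
        (∑ r, (P r).toReal * QLHL.distFromUniform (QLHL.cqOperator (QLHL.hashed (f r) ρ)))
      ≤ ENNReal.ofReal (1 / 2) * ENNReal.ofReal ((2 : ℝ) ^ ((α : ℝ) - β)) *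
          QLHL.twoPow (((-(1 / 2) : ℝ) : EReal) *
            (QLHL.smoothCondMinEntropy ε (QLHL.cqOperator ρ) - (l : EReal)))
        + ENNReal.ofReal ε := by
  rw [← ENNReal.ofReal_mul (by norm_num)]
  refine QLHL.ofReal_le_of_forall_lt (by positivity) hε _ fun t ht => ?_
  obtain ⟨ρ', h1, h2, h3, t', σ, h4, h5, hlt⟩ := QLHL.exists_of_lt_smoothCondMinEntropy ht
  refine (QLHL.sum_prob_mul_distFromUniform_le hl hf hP hρ hρ1 h1 h2 h3 h4 h5).trans ?_
  have htt : t ≤ t' := (EReal.coe_lt_coe_iff.1 hlt).le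
  have : (2 : ℝ) ^ (-(1 / 2) * (t' - l)) ≤ (2 : ℝ) ^ (-(1 / 2) * (t - l)) :=
    Real.rpow_le_rpow_of_exponent_le one_le_two (by linarith)
  gcongr
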